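/- Let $d, r \ge 0$ be integers with $2r \le d$, and let $$\mathrm{Skew}(d;2r) := \{A \in \mathbb{R}^{d\times d} : A^\top = -A,\ \operatorname{rank}(A) = 2r\}$$ be the set of real skew-symmetric $d \times d$ matrices of rank exactly $2r$, with the subspace topology of $\mathbb{R}^{d\times d}$. Then $\mathrm{Skew}(d;2r)$ is non-empty, and it carries the structure of a smooth ($C^\infty$) manifold of dimension $$\dim \mathrm{Skew}(d;2r) = 2dr - (2r^2 + r)$$ for which the inclusion $\mathrm{Skew}(d;2r) \hookrightarrow \mathbb{R}^{d\times d}$ is a smooth embedding and the action $(X, A) \mapsto X A X^\top$ of the Lie group $\mathrm{GL}_d(\mathbb{R})$ on $\mathrm{Skew}(d;2r)$ is a smooth map $\mathrm{GL}_d(\mathbb{R}) \times \mathrm{Skew}(d;2r) \to \mathrm{Skew}(d;2r)$. -/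

import Mathlib

open scoped Manifold ContDiff

-- Topology and smooth structure on `ℝ^{d×d}` are those of a finite-dimensional real vector space;
-- the Frobenius norm is used to present them.
attribute [local instance] Matrix.frobeniusNormedRing Matrix.frobeniusNormedAlgebra

/-- The topology of the Frobenius norm on `ℝ^{d×d}`, which is the usual (entrywise) one. -/
@[reducible]
noncomputable instance matrixNormTopology (d : ℕ) :
    TopologicalSpace (Matrix (Fin d) (Fin d) ℝ) :=
  (Matrix.frobeniusNormedRing :
    NormedRing (Matrix (Fin d) (Fin d) ℝ)).toSeminormedRing.toPseudoMetricSpace.toUniformSpace.toTopologicalSpace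

theorem matrixNormTopology_eq (d : ℕ) :
    matrixNormTopology d =
      (Pi.topologicalSpace : TopologicalSpace (Fin d → Fin d → ℝ)) := rfl

/-- `Skew(d; 2r)`: the real skew-symmetric `d × d` matrices of rank exactly `2r`. -/
def SkewRank (d r : ℕ) : Set (Matrix (Fin d) (Fin d) ℝ) :=
  {A | A.transpose = -A ∧ A.rank = 2 * r}

theorem SkewRank.congr_mem {d r : ℕ} (X : Matrix.GeneralLinearGroup (Fin d) ℝ)
    {A : Matrix (Fin d) (Fin d) ℝ} (hA : A ∈ SkewRank d r) :
    (X : Matrix (Fin d) (Fin d) ℝ) * A * (X : Matrix (Fin d) (Fin d) ℝ).transpose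
      ∈ SkewRank d r := by
  have hX : IsUnit (X : Matrix (Fin d) (Fin d) ℝ).det :=
    (Matrix.isUnit_iff_isUnit_det _).mp X.isUnit
  have hXt : IsUnit (X : Matrix (Fin d) (Fin d) ℝ).transpose.det := by
    rwa [Matrix.det_transpose]
  refine ⟨?_, ?_⟩
  · simp [Matrix.transpose_mul, hA.1, Matrix.mul_assoc]
  · rw [Matrix.rank_mul_eq_left_of_isUnit_det _ _ hXt,
      Matrix.rank_mul_eq_right_of_isUnit_det _ _ hX, hA.2]

/-- The action `(X, A) ↦ X A Xᵀ` of `GL_d(ℝ)` on `Skew(d; 2r)`. -/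
def SkewRank.act {d r : ℕ} (X : Matrix.GeneralLinearGroup (Fin d) ℝ) (A : SkewRank d r) :
    SkewRank d r :=
  ⟨(X : Matrix (Fin d) (Fin d) ℝ) * A.1 * (X : Matrix (Fin d) (Fin d) ℝ).transpose,
    SkewRank.congr_mem X A.2⟩

/-! Congruence brings a point of `SkewRank d r` to the form `[[a, 0], [0, 0]]` with `a` invertible
of size `2r`. For `M = [[a, b], [c, e]]` with `a` invertible, `M` has rank `2r` exactly when the
Schur complement `e - c a⁻¹ b` vanishes. Replacing `e` by this complement is a diffeomorphism, as
the correction does not involve `e`; it sends the skew matrices of rank `2r` to the linear space of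
skew matrices with zero lower right block (`sub_schurCorner_mem_skewCornerFree_iff`). This gives
slice charts, hence an embedded submanifold, of dimension `r(2r - 1) + 2r(d - 2r) = 2dr - (2r² +
r)`. The action is polynomial in the ambient space, and smoothness descends along the embedding. -/

/-! ### Embedded submanifolds from slice charts. -/

section Slice

variable {E F V : Type*} [NormedAddCommGroup E] [NormedSpace ℝ E]
  [NormedAddCommGroup F] [NormedSpace ℝ F] [NormedAddCommGroup V] [NormedSpace ℝ V]

/-- A smooth slice chart of a subset `S` of `V`: a diffeomorphism between open subsets of `V` and
`E × F` under which `S` corresponds to `E × {0}`. -/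
structure IsSliceChart (S : Set V) (Φ : OpenPartialHomeomorph V (E × F)) : Prop where
  contDiffOn : ContDiffOn ℝ ∞ Φ Φ.source
  contDiffOn_symm : ContDiffOn ℝ ∞ Φ.symm Φ.target
  mem_iff : ∀ y ∈ Φ.source, y ∈ S ↔ (Φ y).2 = 0

namespace IsSliceChart

variable {S : Set V} {Φ Ψ : OpenPartialHomeomorph V (E × F)}

theorem symm_mem (h : IsSliceChart S Φ) {u : E} (hu : (u, (0 : F)) ∈ Φ.target) :
    Φ.symm (u, 0) ∈ S := by
  rw [h.mem_iff _ (Φ.map_target hu), Φ.right_inv hu]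

theorem apply_eq (h : IsSliceChart S Φ) {y : V} (hy : y ∈ Φ.source) (hS : y ∈ S) :
    Φ y = ((Φ y).1, 0) :=
  Prod.ext rfl ((h.mem_iff y hy).1 hS)

open Classical in
/-- The chart of `S` with values in `E` induced by a slice chart. -/
noncomputable def chart (h : IsSliceChart S Φ) (x₀ : S) : OpenPartialHomeomorph S E where
  toFun y := (Φ y).1
  -- `x₀` is a junk value, used only off the target.
  invFun u := if hu : (u, (0 : F)) ∈ Φ.target then ⟨Φ.symm (u, 0), h.symm_mem hu⟩ else x₀
  source := {y | (y : V) ∈ Φ.source}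
  target := {u | (u, (0 : F)) ∈ Φ.target}
  map_source' y hy := by
    have := Φ.map_source hy
    rwa [h.apply_eq hy y.2] at this
  map_target' u hu := by
    rw [dif_pos (Set.mem_ofPred.1 hu)]
    exact Φ.map_target hu
  left_inv' y hy := by
    have hmem := Φ.map_source hy
    rw [h.apply_eq hy y.2] at hmem
    rw [dif_pos hmem]
    ext1
    change Φ.symm ((Φ y).1, 0) = y
    rw [← h.apply_eq hy y.2, Φ.left_inv hy]
  right_inv' u hu := by
    rw [dif_pos (Set.mem_ofPred.1 hu)]
    change (Φ (Φ.symm (u, 0))).1 = u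
    rw [Φ.right_inv hu]
  open_source := Φ.open_source.preimage continuous_subtype_val
  open_target := Φ.open_target.preimage (by fun_prop)
  continuousOn_toFun :=
    continuous_fst.comp_continuousOn
      (Φ.continuousOn.comp continuous_subtype_val.continuousOn fun _ hy => hy)
  continuousOn_invFun := by
    rw [Topology.IsInducing.subtypeVal.continuousOn_iff]
    refine (Φ.symm.continuousOn.comp (f := fun u : E => (u, (0 : F)))
      (by fun_prop) fun _ hu => hu).congr fun u hu => ?_
    simp only [Function.comp_apply]
    exact congrArg Subtype.val (dif_pos (Set.mem_ofPred.1 hu))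

theorem chart_symm_apply (h : IsSliceChart S Φ) (x₀ : S) {u : E}
    (hu : (u, (0 : F)) ∈ Φ.target) : ((h.chart x₀).symm u : V) = Φ.symm (u, 0) := by
  classical
  exact congrArg Subtype.val (dif_pos hu)

theorem contDiffOn_chart_symm_trans (h : IsSliceChart S Φ) (h' : IsSliceChart S Ψ) (x₀ x₁ : S) :
    ContDiffOn ℝ ∞ ((h.chart x₀).symm ≫ₕ h'.chart x₁)
      ((h.chart x₀).symm ≫ₕ h'.chart x₁).source := by
  have hsymm : ContDiffOn ℝ ∞ (fun u : E => Φ.symm (u, 0))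
      ((h.chart x₀).symm ≫ₕ h'.chart x₁).source :=
    h.contDiffOn_symm.comp (by fun_prop) fun u hu => hu.1
  have hcomp : ContDiffOn ℝ ∞ (fun u : E => Ψ (Φ.symm (u, 0)))
      ((h.chart x₀).symm ≫ₕ h'.chart x₁).source := by
    refine h'.contDiffOn.comp hsymm fun u hu => ?_
    have h2 : ((h.chart x₀).symm u : V) ∈ Ψ.source := hu.2
    rwa [h.chart_symm_apply x₀ hu.1] at h2
  refine (contDiff_fst.comp_contDiffOn hcomp).congr fun u hu => ?_
  change (Ψ ((h.chart x₀).symm u : V)).1 = _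
  rw [h.chart_symm_apply x₀ hu.1]
  rfl

end IsSliceChart

/-- A subset with slice charts around all its points is an embedded submanifold. -/
theorem exists_isSmoothEmbedding_of_isSliceChart {S : Set V} (L : (E × F) ≃L[ℝ] V)
    (hS : ∀ x : S, ∃ Φ : OpenPartialHomeomorph V (E × F), (x : V) ∈ Φ.source ∧ IsSliceChart S Φ) :
    ∃ _ : ChartedSpace E S, IsManifold 𝓘(ℝ, E) ∞ S ∧
      Manifold.IsSmoothEmbedding 𝓘(ℝ, E) 𝓘(ℝ, V) ∞ (Subtype.val : S → V) := by
  choose Φ hx hΦ using hS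
  let cs : ChartedSpace E S :=
    { atlas := Set.range fun x => (hΦ x).chart x
      chartAt := fun x => (hΦ x).chart x
      mem_chart_source := hx
      chart_mem_atlas := Set.mem_range_self }
  have hman : IsManifold 𝓘(ℝ, E) ∞ S := by
    refine isManifold_of_contDiffOn _ _ _ ?_
    rintro _ _ ⟨x, rfl⟩ ⟨y, rfl⟩
    simpa using (hΦ x).contDiffOn_chart_symm_trans (hΦ y) x y
  -- Charts of `V` must take values in `V` itself, so `L` carries the slice chart from `E × F` back
  -- to `V`.
  have codChart_mem (x : S) : (Φ x).trans L.toHomeomorph.toOpenPartialHomeomorph ∈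
      IsManifold.maximalAtlas 𝓘(ℝ, V) ∞ V := by
    refine OpenPartialHomeomorph.mem_maximalAtlas_of_contMDiffOn _ ?_ ?_
    · rw [contMDiffOn_iff_contDiffOn]
      exact L.contDiff.comp_contDiffOn ((hΦ x).contDiffOn.mono fun y hy => hy.1)
    · rw [contMDiffOn_iff_contDiffOn]
      exact (hΦ x).contDiffOn_symm.comp L.symm.contDiff.contDiffOn fun y hy => hy.2
  refine ⟨cs, hman, ?_, Topology.IsEmbedding.subtypeVal⟩
  refine Manifold.IsImmersionOfComplement.isImmersion (F := F) fun x => ?_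
  refine Manifold.IsImmersionAtOfComplement.mk_of_charts L (chartAt E x)
    ((Φ x).trans L.toHomeomorph.toOpenPartialHomeomorph) (mem_chart_source E x) ?_
    (IsManifold.chart_mem_maximalAtlas x) (codChart_mem x) ?_ ?_
  · simpa using hx x
  · intro y hy
    simpa using (show (y : V) ∈ (Φ x).source from hy)
  · intro u hu
    have hu' : (u, (0 : F)) ∈ (Φ x).target := by
      rw [OpenPartialHomeomorph.extend_target] at hu
      exact hu.1
    -- In these charts the inclusion reads `u ↦ L (u, 0)`.
    change L (Φ x (((hΦ x).chart x).symm u : V)) = L (u, 0)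
    rw [(hΦ x).chart_symm_apply x hu', (Φ x).right_inv hu']

end Slice

/-! ### The Schur complement shear in a ring with an idempotent. -/

section Shear

section Ring

variable {R : Type*} [Ring R]

/-- For `M = [[a, b], [c, e]]` with respect to the idempotent `p`, the corner element
`[[0, 0], [0, c a⁻¹ b]]`. -/
noncomputable def schurCorner (p M : R) : R :=
  (1 - p) * M * p * Ring.inverse (p * M * p + (1 - p)) * (p * M * (1 - p))

/-- The term `c a⁻¹ b` does not see the corner `e`. Hence subtracting it and adding it are mutually
inverse. -/
theorem schurCorner_add {p : R} (hp : p * p = p) (M x : R) :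
    schurCorner p (M + (1 - p) * x * (1 - p)) = schurCorner p M := by
  have h1 : (1 - p) * p = 0 := by rw [sub_mul, hp, one_mul, sub_self]
  have h2 : p * (1 - p) = 0 := by rw [mul_sub, hp, mul_one, sub_self]
  have h3 : (1 - p) * ((1 - p) * x * (1 - p)) * p = 0 := by
    rw [mul_assoc, mul_assoc _ (1 - p) p, h1, mul_zero, mul_zero]
  have h4 : p * ((1 - p) * x * (1 - p)) = 0 := by
    rw [mul_assoc, ← mul_assoc, h2, zero_mul]
  have h5 : (1 - p) * (M + (1 - p) * x * (1 - p)) * p = (1 - p) * M * p := by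
    rw [mul_add, add_mul, h3, add_zero]
  have h6 : p * (M + (1 - p) * x * (1 - p)) = p * M := by
    rw [mul_add, h4, add_zero]
  rw [schurCorner, schurCorner, h5, h6]

theorem schurCorner_eq (p M : R) : ∃ x, schurCorner p M = (1 - p) * x * (1 - p) :=
  ⟨M * p * Ring.inverse (p * M * p + (1 - p)) * (p * M), by simp only [schurCorner, mul_assoc]⟩

theorem mul_sub_corner_mul {p : R} (hp : p * p = p) (M x : R) :
    p * (M + (1 - p) * x * (1 - p)) * p = p * M * p := by
  have h2 : p * (1 - p) = 0 := by rw [mul_sub, hp, mul_one, sub_self]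
  have h4 : p * ((1 - p) * x * (1 - p)) = 0 := by
    rw [mul_assoc, ← mul_assoc, h2, zero_mul]
  rw [mul_add, h4, add_zero]

end Ring

variable {R : Type*} [NormedRing R] [NormedAlgebra ℝ R]

theorem contDiffOn_schurCorner [CompleteSpace R] (p : R) :
    ContDiffOn ℝ ∞ (schurCorner p) {M | IsUnit (p * M * p + (1 - p))} := by
  intro M hM
  obtain ⟨u, hu⟩ := hM
  have hlin : ContDiffAt ℝ ∞ (fun M : R => p * M * p + (1 - p)) M := by fun_prop
  have hinv : ContDiffAt ℝ ∞ (fun M : R => Ring.inverse (p * M * p + (1 - p))) M := by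
    refine ContDiffAt.comp (g := Ring.inverse) M ?_ hlin
    rw [← hu]
    exact contDiffAt_ringInverse ℝ u
  have : ContDiffAt ℝ ∞ (schurCorner p) M :=
    ((by fun_prop : ContDiffAt ℝ ∞ (fun M : R => (1 - p) * M * p) M).mul hinv).mul
      (by fun_prop : ContDiffAt ℝ ∞ (fun M : R => p * M * (1 - p)) M)
  exact this.contDiffWithinAt

/-- The shear `[[a, b], [c, e]] ↦ [[a, b], [c, e - c a⁻¹ b]]` where `a` is invertible. -/
noncomputable def schurShear [CompleteSpace R] {p : R} (hp : p * p = p) :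
    OpenPartialHomeomorph R R where
  toFun M := M - schurCorner p M
  invFun M := M + schurCorner p M
  source := {M | IsUnit (p * M * p + (1 - p))}
  target := {M | IsUnit (p * M * p + (1 - p))}
  map_source' M hM := by
    obtain ⟨x, hx⟩ := schurCorner_eq p M
    have : M - schurCorner p M = M + (1 - p) * (-x) * (1 - p) := by
      rw [hx]; noncomm_ring
    rwa [Set.mem_ofPred_eq, this, mul_sub_corner_mul hp]
  map_target' M hM := by
    obtain ⟨x, hx⟩ := schurCorner_eq p M
    rwa [Set.mem_ofPred_eq, hx, mul_sub_corner_mul hp]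
  left_inv' M _ := by
    obtain ⟨x, hx⟩ := schurCorner_eq p M
    have : M - schurCorner p M = M + (1 - p) * (-x) * (1 - p) := by
      rw [hx]; noncomm_ring
    nth_rewrite 2 [this]
    rw [schurCorner_add hp, sub_add_cancel]
  right_inv' M _ := by
    obtain ⟨x, hx⟩ := schurCorner_eq p M
    nth_rewrite 2 [hx]
    rw [schurCorner_add hp, add_sub_cancel_right]
  open_source := Units.isOpen.preimage (by fun_prop)
  open_target := Units.isOpen.preimage (by fun_prop)
  continuousOn_toFun := continuousOn_id.sub (contDiffOn_schurCorner p).continuousOn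
  continuousOn_invFun := continuousOn_id.add (contDiffOn_schurCorner p).continuousOn

end Shear

/-! ### Rank and skew-symmetry of block matrices. -/

namespace Matrix

variable {κ μ : Type*}

variable (κ μ) in
theorem one_sub_fromBlocks [DecidableEq κ] [DecidableEq μ] :
    1 - fromBlocks 1 0 0 0 = (fromBlocks 0 0 0 1 : Matrix (κ ⊕ μ) (κ ⊕ μ) ℝ) := by
  rw [sub_eq_iff_eq_add, fromBlocks_add, ← fromBlocks_one]
  simp

variable (κ μ) in
/-- Skew-symmetric block matrices with vanishing lower right block. -/
def skewCornerFree : Submodule ℝ (Matrix (κ ⊕ μ) (κ ⊕ μ) ℝ) where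
  carrier := {N | Nᵀ = -N ∧ N.toBlocks₂₂ = 0}
  zero_mem' := ⟨by simp, rfl⟩
  add_mem' {M N} hM hN := ⟨by rw [transpose_add, hM.1, hN.1, neg_add], by
    change M.toBlocks₂₂ + N.toBlocks₂₂ = 0
    rw [hM.2, hN.2, add_zero]⟩
  smul_mem' t M hM := ⟨by rw [transpose_smul, hM.1, smul_neg], by
    change t • M.toBlocks₂₂ = 0
    rw [hM.2, smul_zero]⟩

variable [Fintype κ] [Fintype μ] [DecidableEq κ]

theorem rank_fromBlocks_zero (a : Matrix κ κ ℝ) :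
    (fromBlocks a 0 0 (0 : Matrix μ μ ℝ)).rank = a.rank := by
  apply le_antisymm
  · have : fromBlocks a 0 0 (0 : Matrix μ μ ℝ) =
        (fromRows 1 0 : Matrix (κ ⊕ μ) κ ℝ) * (a * (fromCols 1 0 : Matrix κ (κ ⊕ μ) ℝ)) := by
      rw [mul_fromCols, fromRows_mul_fromCols]
      simp
    rw [this]
    exact (rank_mul_le_right _ _).trans (rank_mul_le_left _ _)
  · have : a = (fromCols 1 0 : Matrix κ (κ ⊕ μ) ℝ) *
        (fromBlocks a 0 0 (0 : Matrix μ μ ℝ) * (fromRows 1 0 : Matrix (κ ⊕ μ) κ ℝ)) := by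
      rw [fromBlocks_mul_fromRows, fromCols_mul_fromRows]
      simp
    calc a.rank = _ := congrArg rank this
      _ ≤ _ := (rank_mul_le_right _ _).trans (rank_mul_le_left _ _)

variable [DecidableEq μ]

/-- The range of `diag(a, 0)` lies in that of `diag(a, s)`; equal ranks make them equal, so each
column `(0, s eⱼ)` has zero lower part. -/
theorem rank_fromBlocks_diag_eq_card_iff {a : Matrix κ κ ℝ} (ha : IsUnit a.det)
    (s : Matrix μ μ ℝ) :
    (fromBlocks a 0 0 s).rank = Fintype.card κ ↔ s = 0 := by
  have ha' : a.rank = Fintype.card κ := rank_of_isUnit a ((isUnit_iff_isUnit_det a).2 ha)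
  constructor
  · intro h
    have hle : LinearMap.range (fromBlocks a 0 0 (0 : Matrix μ μ ℝ)).mulVecLin ≤
        LinearMap.range (fromBlocks a 0 0 s).mulVecLin := by
      have : fromBlocks a 0 0 (0 : Matrix μ μ ℝ) =
          fromBlocks a 0 0 s * fromBlocks 1 0 0 0 := by
        simp [fromBlocks_multiply]
      rw [this, mulVecLin_mul]
      exact LinearMap.range_comp_le_range _ _
    have heq := Submodule.eq_of_le_of_finrank_eq hle
      (((rank_fromBlocks_zero a).trans ha').trans h.symm)
    ext i j
    have hmem : (fromBlocks a 0 0 s).mulVecLin (Sum.elim 0 (Pi.single j 1)) ∈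
        LinearMap.range (fromBlocks a 0 0 (0 : Matrix μ μ ℝ)).mulVecLin := by
      rw [heq]
      exact LinearMap.mem_range_self _ _
    obtain ⟨w, hw⟩ := hmem
    have := congrFun hw (Sum.inr i)
    simpa [fromBlocks_mulVec] using this.symm
  · rintro rfl
    rw [rank_fromBlocks_zero, ha']

/-- Block LDU factorization: the outer factors are unipotent and preserve rank. -/
theorem rank_fromBlocks_eq_card_iff {a : Matrix κ κ ℝ} (ha : IsUnit a.det)
    (b : Matrix κ μ ℝ) (c : Matrix μ κ ℝ) (e : Matrix μ μ ℝ) :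
    (fromBlocks a b c e).rank = Fintype.card κ ↔ e - c * a⁻¹ * b = 0 := by
  let := invertibleOfIsUnitDet a ha
  rw [← rank_fromBlocks_diag_eq_card_iff ha, fromBlocks_eq_of_invertible₁₁, invOf_eq_nonsing_inv,
    rank_mul_eq_left_of_isUnit_det _ _ (by simp), rank_mul_eq_right_of_isUnit_det _ _ (by simp)]

/-- Adding `1 - p` completes `a` to a full-size matrix, so that inverting `a` becomes inversion in
the ring. -/
theorem corner_fromBlocks (a : Matrix κ κ ℝ) (b : Matrix κ μ ℝ) (c : Matrix μ κ ℝ)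
    (e : Matrix μ μ ℝ) :
    fromBlocks 1 0 0 0 * fromBlocks a b c e * fromBlocks 1 0 0 0 + (1 - fromBlocks 1 0 0 0) =
      fromBlocks a 0 0 (1 : Matrix μ μ ℝ) := by
  rw [one_sub_fromBlocks]
  simp [fromBlocks_multiply, fromBlocks_add]

theorem isUnit_corner_iff (a : Matrix κ κ ℝ) (b : Matrix κ μ ℝ) (c : Matrix μ κ ℝ)
    (e : Matrix μ μ ℝ) :
    IsUnit (fromBlocks 1 0 0 0 * fromBlocks a b c e * fromBlocks 1 0 0 0 +
      (1 - fromBlocks 1 0 0 0)) ↔ IsUnit a.det := by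
  rw [corner_fromBlocks, isUnit_iff_isUnit_det]
  simp

theorem fromBlocks_sub_schurCorner {a : Matrix κ κ ℝ} (ha : IsUnit a.det)
    (b : Matrix κ μ ℝ) (c : Matrix μ κ ℝ) (e : Matrix μ μ ℝ) :
    fromBlocks a b c e - schurCorner (fromBlocks 1 0 0 0) (fromBlocks a b c e) =
      fromBlocks a b c (e - c * a⁻¹ * b) := by
  have hinv : (fromBlocks a 0 0 (1 : Matrix μ μ ℝ))⁻¹ = fromBlocks a⁻¹ 0 0 1 := by
    refine inv_eq_right_inv ?_
    simp [fromBlocks_multiply, mul_nonsing_inv a ha]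
  rw [schurCorner, corner_fromBlocks, ← nonsing_inv_eq_ringInverse, hinv, one_sub_fromBlocks]
  simp [fromBlocks_multiply, sub_eq_add_neg, fromBlocks_neg, fromBlocks_add]

theorem sub_schurCorner_mem_skewCornerFree_iff {M : Matrix (κ ⊕ μ) (κ ⊕ μ) ℝ}
    (hM : IsUnit (fromBlocks 1 0 0 0 * M * fromBlocks 1 0 0 0 + (1 - fromBlocks 1 0 0 0))) :
    M - schurCorner (fromBlocks 1 0 0 0) M ∈ skewCornerFree κ μ ↔
      Mᵀ = -M ∧ M.rank = Fintype.card κ := by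
  obtain ⟨a, b, c, e, rfl⟩ : ∃ a b c e, M = fromBlocks a b c e :=
    ⟨_, _, _, _, (fromBlocks_toBlocks M).symm⟩
  rw [isUnit_corner_iff] at hM
  rw [fromBlocks_sub_schurCorner hM, rank_fromBlocks_eq_card_iff hM]
  change (_ ∧ (fromBlocks a b c (e - c * a⁻¹ * b)).toBlocks₂₂ = 0) ↔ _
  rw [toBlocks_fromBlocks₂₂]
  refine and_congr_left fun hs => ?_
  rw [hs]
  simp only [fromBlocks_transpose, fromBlocks_neg, fromBlocks_inj, transpose_zero, neg_zero,
    and_true]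
  refine and_congr_right fun ha => and_congr_right fun hc => ?_
  -- Skewness of `e` comes for free: `e = c a⁻¹ b` with `a` skew and `bᵀ = -c`.
  refine (and_iff_left_of_imp fun hb => ?_).symm
  have hinv : (-a)⁻¹ = -a⁻¹ := inv_eq_right_inv (by rw [neg_mul_neg, mul_nonsing_inv a hM])
  rw [sub_eq_zero.1 hs, transpose_mul, transpose_mul, transpose_nonsing_inv, ha, hb, hc, hinv]
  simp [Matrix.mul_assoc]

end Matrix

/-! ### Dimension of the model space. -/

namespace Matrix

section Dimension

variable {κ μ : Type*} [Fintype κ] [Fintype μ]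

/-- A skew-symmetric block matrix with vanishing lower right block is determined by its strictly
upper triangular entries in the upper left block and by its upper right block. -/
def skewCornerFreeEquiv [DecidableEq κ] [DecidableEq μ] [LinearOrder κ] :
    skewCornerFree κ μ ≃ₗ[ℝ] ({p : κ × κ // p.1 < p.2} → ℝ) × Matrix κ μ ℝ where
  toFun N := (fun p => N.1 (Sum.inl p.1.1) (Sum.inl p.1.2), N.1.toBlocks₁₂)
  map_add' _ _ := rfl
  map_smul' _ _ := rfl
  invFun q := ⟨fromBlocks
      (of fun i j => if h : i < j then q.1 ⟨(i, j), h⟩ else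
        if h : j < i then -q.1 ⟨(j, i), h⟩ else 0) q.2 (-q.2ᵀ) 0, by
    refine ⟨?_, rfl⟩
    rw [fromBlocks_transpose, fromBlocks_neg, fromBlocks_inj]
    refine ⟨?_, by simp, by simp, by simp⟩
    ext i j
    rcases lt_trichotomy i j with h | rfl | h
    · simp [h, h.not_gt]
    · simp
    · simp [h, h.not_gt]⟩
  left_inv N := by
    have hskew : ∀ i j, N.1 j i = -N.1 i j := fun i j => congrFun (congrFun N.2.1 i) j
    ext (i | i) (j | j)
    · rcases lt_trichotomy i j with h | rfl | h
      · simp [h]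
      · have := hskew (Sum.inl i) (Sum.inl i)
        simp only [fromBlocks_apply₁₁, of_apply, lt_irrefl, dite_false]
        linarith
      · simp [h, h.not_gt, hskew (Sum.inl i) (Sum.inl j)]
    · rfl
    · simp [toBlocks₁₂, hskew (Sum.inr i) (Sum.inl j)]
    · exact (congrFun (congrFun N.2.2 i) j).symm
  right_inv q := by
    ext p
    · simp [p.2]
    · rfl

/-- The `k²` pairs split into `<`, `>` and `=`, and swapping matches the first two classes. -/
theorem card_lt_pairs (k : ℕ) :
    2 * Fintype.card {p : Fin k × Fin k // p.1 < p.2} + k = k * k := by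
  have hgt : Fintype.card {p : Fin k × Fin k // p.2 < p.1} =
      Fintype.card {p : Fin k × Fin k // p.1 < p.2} :=
    Fintype.card_congr ((Equiv.prodComm _ _).subtypeEquiv fun _ => Iff.rfl)
  have heq : Fintype.card {p : Fin k × Fin k // p.1 = p.2} = k :=
    (Fintype.card_congr
      { toFun := fun p => p.1.1
        invFun := fun i => ⟨(i, i), rfl⟩
        left_inv := fun ⟨⟨i, j⟩, h⟩ => by cases h; rfl
        right_inv := fun i => rfl }).trans (Fintype.card_fin k)
  have hge : Fintype.card {p : Fin k × Fin k // ¬ p.1 < p.2} =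
      Fintype.card {p : Fin k × Fin k // p.2 < p.1} +
        Fintype.card {p : Fin k × Fin k // p.1 = p.2} := by
    rw [← Fintype.card_subtype_or_disjoint]
    · refine Fintype.card_congr (Equiv.subtypeEquivRight fun p => ?_)
      rw [not_lt, le_iff_lt_or_eq, eq_comm (a := p.2)]
    · rw [Pi.disjoint_iff]
      intro p
      rw [Prop.disjoint_iff]
      rintro ⟨h, h'⟩
      exact h.ne' h'
  have htot := Fintype.card_subtype_compl (fun p : Fin k × Fin k => p.1 < p.2)
  have hle := Fintype.card_subtype_le (fun p : Fin k × Fin k => p.1 < p.2)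
  rw [Fintype.card_prod, Fintype.card_fin] at htot hle
  omega

theorem finrank_skewCornerFree (k m : ℕ) :
    2 * Module.finrank ℝ (skewCornerFree (Fin k) (Fin m)) + k = k * k + 2 * (k * m) := by
  rw [skewCornerFreeEquiv.finrank_eq, Module.finrank_prod, Module.finrank_fintype_fun_eq_card,
    Module.finrank_matrix, Fintype.card_fin, Fintype.card_fin, Module.finrank_self, mul_one]
  have := card_lt_pairs k
  omega

end Dimension

/-! ### Congruence to a single invertible block. -/

section Congruence

variable {δ ι κ μ : Type*} [Fintype δ] [Fintype ι] [DecidableEq δ] [DecidableEq ι]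
  [Fintype κ] [Fintype μ] [DecidableEq κ] [DecidableEq μ]

/-- The linear equivalence `M ↦ Pᵀ M P` for an invertible matrix `P` with inverse `Q`. -/
def congruenceEquiv {P : Matrix δ ι ℝ} {Q : Matrix ι δ ℝ} (hPQ : P * Q = 1) (hQP : Q * P = 1) :
    Matrix δ δ ℝ ≃ₗ[ℝ] Matrix ι ι ℝ where
  toFun M := Pᵀ * M * P
  invFun N := Qᵀ * N * Q
  map_add' M N := by rw [Matrix.mul_add, Matrix.add_mul]
  map_smul' t M := by simp
  left_inv M := by
    have h : Qᵀ * Pᵀ = 1 := by rw [← transpose_mul, hPQ, transpose_one]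
    calc Qᵀ * (Pᵀ * M * P) * Q = (Qᵀ * Pᵀ) * M * (P * Q) := by simp only [Matrix.mul_assoc]
      _ = M := by rw [h, hPQ, Matrix.one_mul, Matrix.mul_one]
  right_inv M := by
    have h : Pᵀ * Qᵀ = 1 := by rw [← transpose_mul, hQP, transpose_one]
    calc Pᵀ * (Qᵀ * M * Q) * P = (Pᵀ * Qᵀ) * M * (Q * P) := by simp only [Matrix.mul_assoc]
      _ = M := by rw [h, hQP, Matrix.one_mul, Matrix.mul_one]

variable {P : Matrix δ ι ℝ} {Q : Matrix ι δ ℝ}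

theorem congruenceEquiv_transpose (hPQ : P * Q = 1) (hQP : Q * P = 1) (M : Matrix δ δ ℝ) :
    (congruenceEquiv hPQ hQP M)ᵀ = congruenceEquiv hPQ hQP Mᵀ := by
  change (Pᵀ * M * P)ᵀ = Pᵀ * Mᵀ * P
  simp [Matrix.mul_assoc]

theorem rank_congruenceEquiv (hPQ : P * Q = 1) (hQP : Q * P = 1) (M : Matrix δ δ ℝ) :
    (congruenceEquiv hPQ hQP M).rank = M.rank := by
  apply le_antisymm
  · exact (rank_mul_le_left _ _).trans (rank_mul_le_right _ _)
  · calc M.rank = (Qᵀ * congruenceEquiv hPQ hQP M * Q).rank :=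
          congrArg rank ((congruenceEquiv hPQ hQP).left_inv M).symm
      _ ≤ _ := (rank_mul_le_left _ _).trans (rank_mul_le_right _ _)

theorem congruenceEquiv_skew_iff (hPQ : P * Q = 1) (hQP : Q * P = 1) (M : Matrix δ δ ℝ) :
    (congruenceEquiv hPQ hQP M)ᵀ = -congruenceEquiv hPQ hQP M ↔ Mᵀ = -M := by
  rw [congruenceEquiv_transpose, ← map_neg, EmbeddingLike.apply_eq_iff_eq]

/-- A basis of `ℝ^d` whose last vectors span the kernel of `A`. -/
theorem exists_basis_mulVec_eq_zero {d k m : ℕ} (A : Matrix (Fin d) (Fin d) ℝ)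
    (hk : A.rank = k) (hd : k + m = d) :
    ∃ b : Module.Basis (Fin k ⊕ Fin m) ℝ (Fin d → ℝ), ∀ j, A *ᵥ b (Sum.inr j) = 0 := by
  obtain ⟨W, hW⟩ := Submodule.exists_isCompl (LinearMap.ker A.mulVecLin)
  have hker : Module.finrank ℝ (LinearMap.ker A.mulVecLin) = m := by
    have h1 := LinearMap.finrank_range_add_finrank_ker A.mulVecLin
    have h2 : Module.finrank ℝ (LinearMap.range A.mulVecLin) = k := hk
    rw [h2, Module.finrank_fin_fun] at h1
    omega
  have hWk : Module.finrank ℝ W = k := by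
    have := Submodule.finrank_add_eq_of_isCompl hW
    rw [hker, Module.finrank_fin_fun] at this
    omega
  refine ⟨((Module.finBasisOfFinrankEq ℝ W hWk).prod (Module.finBasisOfFinrankEq ℝ _ hker)).map
    (Submodule.prodEquivOfIsCompl _ _ hW.symm), fun j => ?_⟩
  have hj : A *ᵥ (Module.finBasisOfFinrankEq ℝ _ hker j : Fin d → ℝ) = 0 :=
    (Module.finBasisOfFinrankEq ℝ _ hker j).2
  simpa using hj

/-- A skew-symmetric matrix is congruent to a block matrix with a single nonzero block, which is
invertible. -/
theorem exists_congruence_fromBlocks {d k m : ℕ} {A : Matrix (Fin d) (Fin d) ℝ}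
    (hA : Aᵀ = -A) (hk : A.rank = k) (hd : k + m = d) :
    ∃ (P : Matrix (Fin d) (Fin k ⊕ Fin m) ℝ) (Q : Matrix (Fin k ⊕ Fin m) (Fin d) ℝ)
      (hPQ : P * Q = 1) (hQP : Q * P = 1) (a : Matrix (Fin k) (Fin k) ℝ),
      IsUnit a.det ∧ congruenceEquiv hPQ hQP A = fromBlocks a 0 0 0 := by
  obtain ⟨b, hb⟩ := exists_basis_mulVec_eq_zero A hk hd
  let P := (Pi.basisFun ℝ (Fin d)).toMatrix b
  let Q := b.toMatrix (Pi.basisFun ℝ (Fin d))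
  have hPQ : P * Q = 1 := Module.Basis.toMatrix_mul_toMatrix_flip _ _
  have hQP : Q * P = 1 := Module.Basis.toMatrix_mul_toMatrix_flip _ _
  have hAP : ∀ i j, (A * P) i (Sum.inr j) = 0 := fun i j => congrFun (hb j) i
  have hcol : ∀ i j, congruenceEquiv hPQ hQP A i (Sum.inr j) = 0 := by
    intro i j
    change (Pᵀ * A * P) i (Sum.inr j) = 0
    rw [Matrix.mul_assoc, Matrix.mul_apply]
    simp [hAP]
  have hskew := (congruenceEquiv_skew_iff hPQ hQP A).2 hA
  -- Skewness turns the zero columns into zero rows.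
  have hrow : ∀ i j, congruenceEquiv hPQ hQP A (Sum.inr j) i = 0 := by
    intro i j
    have := congrFun (congrFun hskew i) (Sum.inr j)
    rw [transpose_apply, neg_apply, hcol, neg_zero] at this
    exact this
  have hblocks : congruenceEquiv hPQ hQP A =
      fromBlocks (congruenceEquiv hPQ hQP A).toBlocks₁₁ 0 0 0 := by
    ext (i | i) (j | j) <;> simp [hcol, hrow, toBlocks₁₁]
  refine ⟨P, Q, hPQ, hQP, _, ?_, hblocks⟩
  have hr := rank_congruenceEquiv hPQ hQP A
  rw [hblocks, rank_fromBlocks_zero, hk] at hr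
  -- The block has full rank `k`, so it is surjective.
  rw [← isUnit_iff_isUnit_det, ← mulVec_surjective_iff_isUnit]
  change Function.Surjective (mulVecLin _)
  rw [← LinearMap.range_eq_top]
  apply Submodule.eq_top_of_finrank_eq
  rw [Module.finrank_fin_fun]
  exact hr

end Congruence

end Matrix

/-! ### The manifold structure and the action. -/

namespace SkewRank

open Matrix

theorem nonempty {d r : ℕ} (hr : 2 * r ≤ d) : (SkewRank d r).Nonempty := by
  let e : (Fin r ⊕ Fin r) ⊕ Fin (d - 2 * r) ≃ Fin d :=
    Fintype.equivFinOfCardEq (by simp; omega)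
  -- The standard symplectic matrix of size `2r`, padded with zeros.
  refine ⟨reindex e e (fromBlocks (J (Fin r) ℝ) 0 0 0), ?_, ?_⟩
  · have hskew : (fromBlocks (J (Fin r) ℝ) 0 0
        (0 : Matrix (Fin (d - 2 * r)) (Fin (d - 2 * r)) ℝ))ᵀ =
        -fromBlocks (J (Fin r) ℝ) 0 0 0 := by
      simp [fromBlocks_transpose, fromBlocks_neg]
    rw [transpose_reindex, hskew]
    rfl
  · rw [rank_reindex, rank_fromBlocks_zero,
      rank_of_isUnit _ ((isUnit_iff_isUnit_det _).2 (isUnit_det_J _ _))]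
    simp [two_mul]

/-- Around each of its points, `Skew(d; 2r)` has a slice chart. -/
theorem exists_isSliceChart {d r m : ℕ} (hd : 2 * r + m = d)
    {E F : Type*} [NormedAddCommGroup E] [NormedSpace ℝ E]
    [NormedAddCommGroup F] [NormedSpace ℝ F]
    (T : Matrix (Fin (2 * r) ⊕ Fin m) (Fin (2 * r) ⊕ Fin m) ℝ ≃L[ℝ] E × F)
    (hT : ∀ N, (T N).2 = 0 ↔ N ∈ skewCornerFree (Fin (2 * r)) (Fin m))
    (A : SkewRank d r) :
    ∃ Φ : OpenPartialHomeomorph (Matrix (Fin d) (Fin d) ℝ) (E × F),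
      (A : Matrix (Fin d) (Fin d) ℝ) ∈ Φ.source ∧ IsSliceChart (SkewRank d r) Φ := by
  obtain ⟨P, Q, hPQ, hQP, a, ha, hAa⟩ := exists_congruence_fromBlocks A.2.1 A.2.2 hd
  have hp : (fromBlocks 1 0 0 0 * fromBlocks 1 0 0 0 :
      Matrix (Fin (2 * r) ⊕ Fin m) (Fin (2 * r) ⊕ Fin m) ℝ) = fromBlocks 1 0 0 0 := by
    simp [fromBlocks_multiply]
  let ℓ := (congruenceEquiv hPQ hQP).toContinuousLinearEquiv
  have hshear : ContDiffOn ℝ ∞ (schurShear hp) (schurShear hp).source :=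
    contDiffOn_id.sub (contDiffOn_schurCorner _)
  have hshear_symm : ContDiffOn ℝ ∞ (schurShear hp).symm (schurShear hp).target :=
    contDiffOn_id.add (contDiffOn_schurCorner _)
  refine ⟨ℓ.toHomeomorph.toOpenPartialHomeomorph ≫ₕ schurShear hp ≫ₕ
    T.toHomeomorph.toOpenPartialHomeomorph, ?_, ?_, ?_, ?_⟩
  · refine ⟨trivial, ?_, trivial⟩
    change IsUnit (_ * congruenceEquiv hPQ hQP A * _ + _)
    rw [hAa]
    exact (isUnit_corner_iff _ _ _ _).2 ha
  · exact T.contDiff.comp_contDiffOn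
      (hshear.comp ℓ.contDiff.contDiffOn fun M hM => hM.2.1)
  · exact ℓ.symm.contDiff.comp_contDiffOn
      (hshear_symm.comp T.symm.contDiff.contDiffOn fun u hu => hu.1.2)
  · intro M hM
    have hM' : IsUnit (fromBlocks 1 0 0 0 * congruenceEquiv hPQ hQP M * fromBlocks 1 0 0 0 +
        (1 - fromBlocks 1 0 0 0)) := hM.2.1
    refine Iff.trans ?_ (hT (congruenceEquiv hPQ hQP M -
      schurCorner (fromBlocks 1 0 0 0) (congruenceEquiv hPQ hQP M))).symm
    rw [sub_schurCorner_mem_skewCornerFree_iff hM', congruenceEquiv_skew_iff,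
      rank_congruenceEquiv, Fintype.card_fin]
    rfl

theorem exists_chartedSpace {d r n : ℕ} (hr : 2 * r ≤ d)
    (hn : (n : ℤ) = 2 * d * r - (2 * r ^ 2 + r)) :
    ∃ _ : ChartedSpace (EuclideanSpace ℝ (Fin n)) (SkewRank d r),
      IsManifold (𝓡 n) ∞ (SkewRank d r) ∧
      Manifold.IsSmoothEmbedding (𝓡 n) 𝓘(ℝ, Matrix (Fin d) (Fin d) ℝ) ∞
        (Subtype.val : SkewRank d r → Matrix (Fin d) (Fin d) ℝ) := by
  obtain ⟨m, rfl⟩ := Nat.exists_eq_add_of_le hr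
  let W := skewCornerFree (Fin (2 * r)) (Fin m)
  -- `W'` supplies the normal directions; one splitting serves the charts at all points.
  obtain ⟨W', hW⟩ := Submodule.exists_isCompl W
  have hWn : Module.finrank ℝ W = n := by
    have h := finrank_skewCornerFree (2 * r) m
    zify at h
    push_cast at hn
    have : ((Module.finrank ℝ W : ℕ) : ℤ) = n := by
      rw [hn]
      linarith
    exact_mod_cast this
  let eW : W ≃ₗ[ℝ] EuclideanSpace ℝ (Fin n) :=
    LinearEquiv.ofFinrankEq _ _ (by rw [hWn, finrank_euclideanSpace_fin])
  let T₀ := (Submodule.prodEquivOfIsCompl W W' hW).symm.trans (eW.prodCongr (.refl ℝ W'))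
  have hT₀ : ∀ N, (T₀ N).2 = 0 ↔ N ∈ W := fun N =>
    Submodule.prodEquivOfIsCompl_symm_apply_snd_eq_zero _ _ hW
  let T := T₀.toContinuousLinearEquiv
  let L : (EuclideanSpace ℝ (Fin n) × W') ≃L[ℝ]
      Matrix (Fin (2 * r + m)) (Fin (2 * r + m)) ℝ :=
    T.symm.trans
      (reindexLinearEquiv ℝ ℝ finSumFinEquiv finSumFinEquiv).toContinuousLinearEquiv
  exact exists_isSmoothEmbedding_of_isSliceChart L (exists_isSliceChart rfl T hT₀)

/-- A continuous map into an immersed manifold is smooth once its composite with the immersion is;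
continuity holds because the topology is induced. -/
theorem contMDiff_act {d r n : ℕ} [ChartedSpace (EuclideanSpace ℝ (Fin n)) (SkewRank d r)]
    (h : Manifold.IsSmoothEmbedding (𝓡 n) 𝓘(ℝ, Matrix (Fin d) (Fin d) ℝ) ∞
      (Subtype.val : SkewRank d r → Matrix (Fin d) (Fin d) ℝ)) :
    ContMDiff (𝓘(ℝ, Matrix (Fin d) (Fin d) ℝ).prod (𝓡 n)) (𝓡 n) ∞
      (fun p : Matrix.GeneralLinearGroup (Fin d) ℝ × SkewRank d r => act p.1 p.2) := by
  have hX : ContMDiff (𝓘(ℝ, Matrix (Fin d) (Fin d) ℝ).prod (𝓡 n))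
      𝓘(ℝ, Matrix (Fin d) (Fin d) ℝ) ∞
      (fun p : Matrix.GeneralLinearGroup (Fin d) ℝ × SkewRank d r =>
        (p.1 : Matrix (Fin d) (Fin d) ℝ)) :=
    Units.contMDiff_val.comp contMDiff_fst
  have hA : ContMDiff (𝓘(ℝ, Matrix (Fin d) (Fin d) ℝ).prod (𝓡 n))
      𝓘(ℝ, Matrix (Fin d) (Fin d) ℝ) ∞
      (fun p : Matrix.GeneralLinearGroup (Fin d) ℝ × SkewRank d r =>
        (p.2 : Matrix (Fin d) (Fin d) ℝ)) :=
    h.contMDiff.comp contMDiff_snd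
  let τ := (transposeLinearEquiv (Fin d) (Fin d) ℝ ℝ).toContinuousLinearEquiv
  have hsmooth : ContDiff ℝ ∞
      (fun q : Matrix (Fin d) (Fin d) ℝ × Matrix (Fin d) (Fin d) ℝ => q.1 * q.2 * τ q.1) :=
    (contDiff_fst.mul contDiff_snd).mul (τ.contDiff.comp contDiff_fst)
  have hval : ContMDiff (𝓘(ℝ, Matrix (Fin d) (Fin d) ℝ).prod (𝓡 n))
      𝓘(ℝ, Matrix (Fin d) (Fin d) ℝ) ∞
      ((Subtype.val : SkewRank d r → Matrix (Fin d) (Fin d) ℝ) ∘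
        fun p : Matrix.GeneralLinearGroup (Fin d) ℝ × SkewRank d r => act p.1 p.2) :=
    hsmooth.contMDiff.comp (hX.prodMk_space hA)
  intro p
  rw [ContMDiffAt.iff_comp_isImmersionAt (h.isImmersion.isImmersionAt _)]
  exact ⟨(continuous_induced_rng.2 hval.continuous).continuousAt, hval p⟩

end SkewRank

theorem propositionG1 (d r : ℕ) (hr : 2 * r ≤ d) :
    (SkewRank d r).Nonempty ∧
    ∃ (n : ℕ) (_ : ChartedSpace (EuclideanSpace ℝ (Fin n)) (SkewRank d r)),
      (n : ℤ) = 2 * d * r - (2 * r ^ 2 + r) ∧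
      IsManifold (𝓡 n) ∞ (SkewRank d r) ∧
      Manifold.IsSmoothEmbedding (𝓡 n) 𝓘(ℝ, Matrix (Fin d) (Fin d) ℝ) ∞
        (Subtype.val : SkewRank d r → Matrix (Fin d) (Fin d) ℝ) ∧
      ContMDiff (𝓘(ℝ, Matrix (Fin d) (Fin d) ℝ).prod (𝓡 n)) (𝓡 n) ∞
        (fun p : Matrix.GeneralLinearGroup (Fin d) ℝ × SkewRank d r =>
          SkewRank.act p.1 p.2) := by
  refine ⟨SkewRank.nonempty hr, ?_⟩
  -- From `2r ≤ d` one gets `2dr ≥ 4r²`, and `r ≤ r²` does the rest.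
  have hnonneg : (0 : ℤ) ≤ 2 * d * r - (2 * r ^ 2 + r) := by
    have h : (2 * r : ℤ) ≤ d := by exact_mod_cast hr
    have h' : (r : ℤ) ≤ r * r := by exact_mod_cast Nat.le_mul_self r
    nlinarith [mul_le_mul_of_nonneg_right h (Int.natCast_nonneg r)]
  obtain ⟨n, hn⟩ := Int.eq_ofNat_of_zero_le hnonneg
  obtain ⟨cs, hman, hemb⟩ := SkewRank.exists_chartedSpace hr hn.symm
  exact ⟨n, cs, hn.symm, hman, hemb, SkewRank.contMDiff_act hemb⟩
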